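/- Let $T$ be the class of typically real functions, i.e. functions $f(z)=z+\sum_{k\ge 2}a_kz^k$ analytic in the open unit disc $\mathbb{D}$ that take real values at the real points of $\mathbb{D}$ and non-real values at all other points of $\mathbb{D}$. Let $f\in T$, let $\lambda\ge 1$ be real, and let $n,m\ge 2$ be integers. (i) If $n=2$ and $m$ is even, then $$|\lambda a_na_m-a_{n+m-1}|\le\begin{cases}3+(2\lambda-1)(m-2), & 1\le\lambda\le 3/2,\quad (a)\\ 2\lambda m-m-1, & \lambda\ge 3/2.\quad (b)\end{cases}$$ (ii) If $m=2$ and $n$ is even, then $$|\lambda a_na_m-a_{n+m-1}|\le\begin{cases}3+(2\lambda-1)(n-2), & 1\le\lambda\le 3/2,\quad (a)\\ 2\lambda n-n-1, & \lambda\ge 3/2.\quad (b)\end{cases}$$ (iii) In all other cases, $$|\lambda a_na_m-a_{n+m-1}|\le\lambda mn-n-m+1.$$ The bounds in (i)(b), (ii)(b) and (iii) are sharp, that is, for all such $n,m,\lambda$ equality holds for some $f\in T$. The bounds in (i)(a) and (ii)(a) are sharp in the same sense when $\lambda=1$ or when $n=m=2$. -/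

import Mathlib

/-- The class `𝒜`: functions analytic on the open unit disc with `f 0 = 0` and `f' 0 = 1`.
Only the values of `f` on the unit disc matter. -/
def NormalizedAnalytic : Set (ℂ → ℂ) :=
  {f | DifferentiableOn ℂ f (Metric.ball 0 1) ∧ f 0 = 0 ∧ deriv f 0 = 1}

/-- The class `T` of typically real functions: members of `𝒜` that take real values at the real
points of the unit disc and non-real values at all its other points. -/
def TypicallyReal : Set (ℂ → ℂ) :=
  {f | f ∈ NormalizedAnalytic ∧ ∀ z ∈ Metric.ball (0 : ℂ) 1, (f z).im = 0 ↔ z.im = 0}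

/-- The `n`-th Taylor coefficient `a_n` of `f` at the origin. -/
noncomputable def taylorCoeff (f : ℂ → ℂ) (n : ℕ) : ℂ :=
  iteratedDeriv n f 0 / (n.factorial : ℂ)

/-- The generalized Zalcman functional `φ(f, n, m; lam) = |lam * a_n * a_m - a_{n+m-1}|`. -/
noncomputable def zalcman (f : ℂ → ℂ) (n m : ℕ) (lam : ℝ) : ℝ :=
  ‖(lam : ℂ) * taylorCoeff f n * taylorCoeff f m - taylorCoeff f (n + m - 1)‖

/-! For typically real `f`, `Im f(z)` has the sign of `Im z`, so on `|z| = r` the function `Im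
f(re^{iθ}) sin θ / (π r)` is a probability density. Since `sin((n+2)θ) - sin(nθ) = 2 cos((n+1)θ) sin
θ`, its cosine moments `c j` give `a_n r^n = r A_n` with `A_{n+2} = A_n + 2 c (n+1)`. Bounds uniform
in `r` pass to `r → 1`, so no representing measure on the limit circle is needed.

What remains is algebra with `|c j| ≤ 1` and `|2 c j c k - c (j+k)| ≤ 1`. Raising `n` by 2 adds one
block, bounded by exactly the growth of the bound in (iii). Odd `n` starts this induction at `A_1 =
1`. For even `n` and `m` the start contains `4λ (c 1)² - 2 c 2 - 1`, which lies in `[-3, 4λ - 3]`;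
the two ends balance at `λ = 3/2`, whence the split in (i) and (ii). With both indices at least 4,
the moment `c 3` repairs the lower end.

The Koebe function and its odd part are the extremal functions. -/

/-- Taylor coefficients of a power series expansion valid on the unit disc. -/
theorem taylorCoeff_eq_of_hasSum {f : ℂ → ℂ} {a : ℕ → ℂ}
    (h : ∀ z : ℂ, ‖z‖ < 1 → HasSum (fun n => a n * z ^ n) (f z)) (n : ℕ) :
    taylorCoeff f n = a n := by
  have h1 : HasFPowerSeriesAt f (FormalMultilinearSeries.ofScalars ℂ a) 0 := by
    rw [hasFPowerSeriesAt_iff]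
    filter_upwards [Metric.ball_mem_nhds (0 : ℂ) one_pos] with z hz
    have := h z (by simpa using hz)
    simpa [mul_comm] using this
  have h2 := AnalyticAt.hasFPowerSeriesAt ⟨_, h1⟩
  have h3 := congrArg (fun p => FormalMultilinearSeries.coeff p n)
    (h2.eq_formalMultilinearSeries h1)
  simpa [taylorCoeff] using h3

theorem hasSum_taylorCoeff {f : ℂ → ℂ} (hf : DifferentiableOn ℂ f (Metric.ball 0 1)) {z : ℂ}
    (hz : z ∈ Metric.ball (0 : ℂ) 1) : HasSum (fun n => taylorCoeff f n * z ^ n) (f z) := by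
  refine (Complex.hasSum_taylorSeries_on_ball hf hz).congr_fun fun n => ?_
  simp only [taylorCoeff, sub_zero, smul_eq_mul]
  ring

/-! ### Real coefficients and the sign of `Im f`. -/

namespace TypicallyReal

variable {f : ℂ → ℂ}

theorem taylorCoeff_zero (hf : f ∈ TypicallyReal) : taylorCoeff f 0 = 0 := by
  simp [taylorCoeff, hf.1.2.1]

theorem taylorCoeff_one (hf : f ∈ TypicallyReal) : taylorCoeff f 1 = 1 := by
  simp [taylorCoeff, hf.1.2.2]

/-- On the real diameter `Im f` is the real power series with coefficients `Im a_n`, and it vanishes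
there. -/
theorem taylorCoeff_im (hf : f ∈ TypicallyReal) (n : ℕ) : (taylorCoeff f n).im = 0 := by
  have h1 : HasFPowerSeriesAt (0 : ℝ → ℝ)
      (FormalMultilinearSeries.ofScalars ℝ fun n => (taylorCoeff f n).im) 0 := by
    rw [hasFPowerSeriesAt_iff]
    filter_upwards [Metric.ball_mem_nhds (0 : ℝ) one_pos] with x hx
    have hx' : (x : ℂ) ∈ Metric.ball (0 : ℂ) 1 := by simpa using hx
    have h := Complex.hasSum_im (hasSum_taylorCoeff hf.1.1 hx')
    have h0 : (f x).im = 0 := (hf.2 x hx').2 (Complex.ofReal_im x)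
    rw [h0] at h
    refine h.congr_fun ?_
    intro k
    rw [← Complex.ofReal_pow, Complex.im_mul_ofReal]
    simp [mul_comm]
  have h2 := congrArg (fun p => FormalMultilinearSeries.coeff p n) h1.eq_zero
  rwa [FormalMultilinearSeries.coeff_ofScalars] at h2

theorem taylorCoeff_eq_re (hf : f ∈ TypicallyReal) (n : ℕ) :
    taylorCoeff f n = ((taylorCoeff f n).re : ℂ) :=
  Complex.ext rfl (by simpa using taylorCoeff_im hf n)

/-- Near the origin, `Im f` has the sign of `Im z` along the imaginary axis. -/
theorem exists_im_pos (hf : f ∈ TypicallyReal) {s : ℝ} (hs : s ^ 2 = 1) :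
    ∃ t ∈ Set.Ioo (0 : ℝ) 1, 0 < s * (f (s * t * Complex.I)).im := by
  have hd : HasDerivAt f 1 0 := by
    have := (hf.1.1.differentiableAt (Metric.ball_mem_nhds (0 : ℂ) one_pos)).hasDerivAt
    rwa [hf.1.2.2] at this
  have hg : HasDerivAt (fun t : ℝ => f (s * t * Complex.I)) (s * Complex.I) 0 := by
    have h1 : HasDerivAt (fun t : ℝ => (s : ℂ) * t * Complex.I) (s * Complex.I) 0 := by
      simpa using ((Complex.ofRealCLM.hasDerivAt (x := 0)).const_mul (s : ℂ)).mul_const Complex.I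
    have h2 : HasDerivAt f 1 ((s : ℂ) * ((0 : ℝ) : ℂ) * Complex.I) := by simpa using hd
    simpa [Function.comp_def] using HasDerivAt.comp (0 : ℝ) h2 h1
  -- As `f'(0) = 1`, the derivative at `t = 0` is `s² = 1`.
  have hi : HasDerivAt (fun t : ℝ => s * (f (s * t * Complex.I)).im) 1 0 := by
    have h3 := (Complex.imCLM.hasFDerivAt.comp_hasDerivAt (0 : ℝ) hg).const_mul s
    have h4 : s * Complex.imCLM (s * Complex.I) = 1 := by simp [← sq, hs]
    rw [h4] at h3
    exact h3
  have hslope := hi.tendsto_slope_zero_right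
  have hev := (hslope.eventually (lt_mem_nhds (zero_lt_one (α := ℝ)))).and
    (Ioo_mem_nhdsGT (zero_lt_one (α := ℝ)))
  obtain ⟨t, ht, ht'⟩ := hev.exists
  refine ⟨t, ht', ?_⟩
  simp [hf.1.2.1] at ht
  exact (mul_pos_iff_of_pos_left (inv_pos.2 ht'.1)).1 (by simpa using ht)

/-- Each open half disc is convex and `Im f` has no zero in it, so the sign found near the origin
persists by the intermediate value theorem. -/
theorem im_mul_im_nonneg (hf : f ∈ TypicallyReal) {z : ℂ} (hz : z ∈ Metric.ball (0 : ℂ) 1) :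
    0 ≤ (f z).im * z.im := by
  have key : ∀ s : ℝ, s ^ 2 = 1 → 0 < s * z.im → 0 < s * (f z).im := by
    intro s hs hsz
    by_contra! hneg
    obtain ⟨t, ht, hpos⟩ := exists_im_pos hf hs
    let S : Set ℂ := Metric.ball 0 1 ∩ {w | 0 < s * w.im}
    have hconv : Convex ℝ S := by
      refine (convex_ball _ _).inter ?_
      have : IsLinearMap ℝ fun w : ℂ => s * w.im :=
        ⟨fun _ _ => by simp [mul_add], fun _ _ => by simp; ring⟩
      exact convex_halfSpace_gt this 0
    have hcont : ContinuousOn (fun w => s * (f w).im) S :=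
      continuousOn_const.mul (Complex.continuous_im.comp_continuousOn
        (hf.1.1.continuousOn.mono Set.inter_subset_left))
    have hw : (s * t * Complex.I : ℂ) ∈ S := by
      refine ⟨?_, ?_⟩
      · have : |s| = 1 := by rwa [← sq_eq_sq₀ (abs_nonneg s) zero_le_one, sq_abs, one_pow]
        simp [this, abs_of_pos ht.1, ht.2]
      · have : s * (s * t) = t := by rw [← mul_assoc, ← sq, hs, one_mul]
        simp [this, ht.1]
    obtain ⟨w, hwS, hw0⟩ := hconv.isPreconnected.intermediate_value (a := z) ⟨hz, hsz⟩ hw hcont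
      ⟨hneg, hpos.le⟩
    have hs0 : s ≠ 0 := by rintro rfl; simp at hs
    have h1 : (f w).im = 0 := by simpa [hs0] using hw0
    have h2 := (hf.2 w hwS.1).1 h1
    have h3 : 0 < s * w.im := hwS.2
    simp [h2] at h3
  rcases lt_trichotomy z.im 0 with h | h | h
  · have := key (-1) (by norm_num) (by linarith)
    exact mul_nonneg_of_nonpos_of_nonpos (by linarith) h.le
  · simp [h]
  · have := key 1 (by norm_num) (by linarith)
    exact mul_nonneg (by linarith) h.le

end TypicallyReal

/-! ### Fourier coefficients on circles. -/

section CircleIntegrals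

variable {f : ℂ → ℂ} {r : ℝ}

theorem integral_mul_exp_neg (hf : DifferentiableOn ℂ f (Metric.ball 0 1)) (hr : 0 < r)
    (hr1 : r < 1) (n : ℕ) :
    ∫ θ in (0 : ℝ)..2 * Real.pi, f (circleMap 0 r θ) * Complex.exp (-(n * θ * Complex.I))
      = 2 * Real.pi * r ^ n * taylorCoeff f n := by
  have h := (hf.mono (Metric.closedBall_subset_ball hr1)).circleIntegral_one_div_sub_center_pow_smul
    hr n
  have hr0 : (r : ℂ) ≠ 0 := by exact_mod_cast hr.ne'
  have h2 : (∮ z in C(0, r), (1 / (z - 0) ^ (n + 1)) • f z) = Complex.I / r ^ n *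
      ∫ θ in (0 : ℝ)..2 * Real.pi, f (circleMap 0 r θ) * Complex.exp (-(n * θ * Complex.I)) := by
    rw [circleIntegral, ← intervalIntegral.integral_const_mul]
    congr 1
    ext θ
    have he := Complex.exp_ne_zero (θ * Complex.I)
    simp only [deriv_circleMap, circleMap, smul_eq_mul, sub_zero, zero_add]
    rw [Complex.exp_neg, mul_assoc (n : ℂ), Complex.exp_nat_mul]
    rw [one_div, mul_pow, ← div_eq_mul_inv, pow_succ, pow_succ]
    field_simp
  rw [h2] at h
  have hI := Complex.I_ne_zero
  have hfac : (n.factorial : ℂ) ≠ 0 := by exact_mod_cast n.factorial_ne_zero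
  simp only [smul_eq_mul] at h
  rw [taylorCoeff]
  field_simp at h ⊢
  linear_combination h

/-- Cauchy's theorem for `z^n f(z)`: negative frequencies are absent. -/
theorem integral_mul_exp (hf : DifferentiableOn ℂ f (Metric.ball 0 1)) (hr : 0 < r)
    (hr1 : r < 1) (n : ℕ) :
    ∫ θ in (0 : ℝ)..2 * Real.pi,
      f (circleMap 0 r θ) * Complex.exp ((n + 1 : ℕ) * θ * Complex.I) = 0 := by
  have hd : DifferentiableOn ℂ (fun z => z ^ n * f z) (Metric.ball 0 1) :=
    (differentiableOn_id.pow n).mul hf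
  have h := Complex.circleIntegral_eq_zero_of_differentiable_on_off_countable hr.le
    Set.countable_empty (hd.continuousOn.mono (Metric.closedBall_subset_ball hr1))
    (fun z hz => hd.differentiableAt (Metric.isOpen_ball.mem_nhds
      (Metric.ball_subset_ball hr1.le hz.1)))
  have hr0 : (r : ℂ) ≠ 0 := by exact_mod_cast hr.ne'
  have h2 : (∮ z in C(0, r), z ^ n * f z) = Complex.I * r ^ (n + 1) *
      ∫ θ in (0 : ℝ)..2 * Real.pi,
        f (circleMap 0 r θ) * Complex.exp ((n + 1 : ℕ) * θ * Complex.I) := by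
    rw [circleIntegral, ← intervalIntegral.integral_const_mul]
    congr 1
    ext θ
    simp only [deriv_circleMap, circleMap, smul_eq_mul, zero_add]
    rw [mul_assoc ((n + 1 : ℕ) : ℂ), Complex.exp_nat_mul]
    ring
  rw [h2] at h
  simpa [hr0] using h

theorem continuous_comp_circleMap (hf : DifferentiableOn ℂ f (Metric.ball 0 1)) (hr : 0 < r)
    (hr1 : r < 1) : Continuous fun θ : ℝ => f (circleMap 0 r θ) :=
  hf.continuousOn.comp_continuous (continuous_circleMap 0 r) fun θ => by
    simpa [circleMap, abs_of_pos hr] using hr1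

theorem integral_im_mul_sin (hf : DifferentiableOn ℂ f (Metric.ball 0 1)) (hr : 0 < r)
    (hr1 : r < 1) (n : ℕ) :
    ∫ θ in (0 : ℝ)..2 * Real.pi, (f (circleMap 0 r θ)).im * Real.sin ((n + 1 : ℕ) * θ)
      = Real.pi * r ^ (n + 1) * (taylorCoeff f (n + 1)).re := by
  have hc := continuous_comp_circleMap hf hr hr1
  have h1 := integral_mul_exp_neg hf hr hr1 (n + 1)
  have h2 := integral_mul_exp hf hr hr1 n
  have h3 : ∫ θ in (0 : ℝ)..2 * Real.pi, f (circleMap 0 r θ) * (Real.sin ((n + 1 : ℕ) * θ) : ℂ)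
      = ((Real.pi * r ^ (n + 1) : ℝ) : ℂ) * (Complex.I * taylorCoeff f (n + 1)) := by
    have : ∀ θ : ℝ, f (circleMap 0 r θ) * (Real.sin ((n + 1 : ℕ) * θ) : ℂ)
        = (f (circleMap 0 r θ) * Complex.exp (-((n + 1 : ℕ) * θ * Complex.I))
          - f (circleMap 0 r θ) * Complex.exp ((n + 1 : ℕ) * θ * Complex.I))
          * (Complex.I / 2) := by
      intro θ
      rw [Complex.ofReal_sin, Complex.sin]
      push_cast
      ring_nf
    simp_rw [this]
    rw [intervalIntegral.integral_mul_const, intervalIntegral.integral_sub, h1, h2]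
    · push_cast; ring
    · exact Continuous.intervalIntegrable (hc.mul (by fun_prop)) _ _
    · exact Continuous.intervalIntegrable (hc.mul (by fun_prop)) _ _
  have h4 := Complex.imCLM.intervalIntegral_comp_comm (a := 0) (b := 2 * Real.pi)
    (μ := MeasureTheory.volume)
    (f := fun θ => f (circleMap 0 r θ) * (Real.sin ((n + 1 : ℕ) * θ) : ℂ))
    (Continuous.intervalIntegrable (hc.mul (by fun_prop)) _ _)
  rw [h3] at h4
  simp only [Complex.imCLM_apply, Complex.im_mul_ofReal, Complex.im_ofReal_mul] at h4
  rw [h4]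
  simp

end CircleIntegrals

/-! ### Estimates in terms of cosine moments. -/

/-- The properties of the cosine moments `c j = ∫ cos (j θ) dμ(θ)` of a probability measure `μ`
from which the coefficient estimates follow. -/
structure IsCosMoment (c : ℕ → ℝ) : Prop where
  abs_le_one : ∀ j, |c j| ≤ 1
  abs_two_mul_sub_le : ∀ j k, |2 * (c j * c k) - c (j + k)| ≤ 1
  abs_two_mul_sub_le' : ∀ j k, |2 * (c (j + k) * c k) - c j| ≤ 1

/-- The moments `∫ sin (n θ) / sin θ dμ(θ)` expressed through cosine moments. -/
def sinRatioMoment (c : ℕ → ℝ) : ℕ → ℝ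
  | 0 => 0
  | 1 => 1
  | n + 2 => sinRatioMoment c n + 2 * c (n + 1)

namespace IsCosMoment

variable {c : ℕ → ℝ} {lam : ℝ}

local notation "A" => sinRatioMoment c

theorem abs_sinRatioMoment_le (hc : IsCosMoment c) : ∀ n : ℕ, |A n| ≤ n
  | 0 => by simp [sinRatioMoment]
  | 1 => by simp [sinRatioMoment]
  | n + 2 => by
    have h1 := abs_le.1 (abs_sinRatioMoment_le hc n)
    have h2 := abs_le.1 (hc.abs_le_one (n + 1))
    rw [sinRatioMoment, abs_le]
    push_cast
    constructor <;> linarith [h1.1, h1.2, h2.1, h2.2]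

theorem abs_mul_le_one (hc : IsCosMoment c) (j k : ℕ) : |c j * c k| ≤ 1 := by
  rw [abs_mul]
  exact mul_le_one₀ (hc.abs_le_one j) (abs_nonneg _) (hc.abs_le_one k)

/-- The quantity is `2 (2 c j c k - c (j+k)) + 4 (λ - 1) c j c k`. -/
theorem abs_four_mul_sub_le (hc : IsCosMoment c) (hlam : 1 ≤ lam) (j k : ℕ) :
    |4 * lam * (c j * c k) - 2 * c (j + k)| ≤ 4 * lam - 2 := by
  have h1 := abs_le.1 (hc.abs_two_mul_sub_le j k)
  have h2 := abs_le.1 (hc.abs_mul_le_one j k)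
  rw [abs_le]
  constructor <;> nlinarith [h1.1, h1.2, h2.1, h2.2]

/-- The contribution of a single cosine moment of `a_n` to the functional. -/
theorem abs_block_le (hc : IsCosMoment c) (hlam : 1 ≤ lam) (j m : ℕ) :
    |2 * lam * (c j * A (m + 2)) - 2 * c (j + (m + 1))| ≤ 2 * lam * (m + 2) - 2 := by
  have h1 := hc.abs_four_mul_sub_le hlam j (m + 1)
  have h2 : |2 * lam * (c j * A m)| ≤ 2 * lam * m := by
    rw [abs_mul, abs_mul (c j), abs_of_nonneg (by linarith : 0 ≤ 2 * lam)]
    have := mul_le_mul (hc.abs_le_one j) (hc.abs_sinRatioMoment_le m) (abs_nonneg _) zero_le_one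
    rw [one_mul] at this
    exact mul_le_mul_of_nonneg_left this (by linarith)
  have h3 := abs_add_le (4 * lam * (c j * c (m + 1)) - 2 * c (j + (m + 1)))
    (2 * lam * (c j * A m))
  rw [sinRatioMoment]
  calc _ = |4 * lam * (c j * c (m + 1)) - 2 * c (j + (m + 1)) + 2 * lam * (c j * A m)| := by
        ring_nf
    _ ≤ _ := by linarith

/-- Induction on blocks from `A_1 = 1`, where the functional is `(λ - 1) A_{m+2}`. -/
theorem abs_le_of_odd (hc : IsCosMoment c) (hlam : 1 ≤ lam) (m : ℕ) : ∀ h : ℕ,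
    |lam * A (2 * h + 1) * A (m + 2) - A (2 * h + (m + 2))|
      ≤ lam * (2 * h + 1) * (m + 2) - (2 * h + 1) - (m + 2) + 1
  | 0 => by
    have h1 := hc.abs_sinRatioMoment_le (m + 2)
    have h2 : lam * A (2 * 0 + 1) * A (m + 2) - A (2 * 0 + (m + 2)) = (lam - 1) * A (m + 2) := by
      simp [sinRatioMoment]; ring
    rw [h2, abs_mul, abs_of_nonneg (by linarith : 0 ≤ lam - 1)]
    push_cast at h1 ⊢
    nlinarith
  | h + 1 => by
    have h1 := abs_le_of_odd hc hlam m h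
    have h2 := hc.abs_block_le hlam (2 * h + 2) m
    have e1 : A (2 * (h + 1) + 1) = A (2 * h + 1) + 2 * c (2 * h + 2) := rfl
    have e2 : A (2 * (h + 1) + (m + 2)) = A (2 * h + (m + 2)) + 2 * c (2 * h + 2 + (m + 1)) := by
      rw [show 2 * (h + 1) + (m + 2) = 2 * h + (m + 2) + 2 by ring, sinRatioMoment]
      congr 3; ring
    rw [e1, e2]
    have h3 := abs_add_le (lam * A (2 * h + 1) * A (m + 2) - A (2 * h + (m + 2)))
      (2 * lam * (c (2 * h + 2) * A (m + 2)) - 2 * c (2 * h + 2 + (m + 1)))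
    push_cast
    calc _ = |lam * A (2 * h + 1) * A (m + 2) - A (2 * h + (m + 2))
        + (2 * lam * (c (2 * h + 2) * A (m + 2)) - 2 * c (2 * h + 2 + (m + 1)))| := by ring_nf
      _ ≤ _ := by linarith

theorem sinRatioMoment_two (c : ℕ → ℝ) : sinRatioMoment c 2 = 2 * c 1 := by simp [sinRatioMoment]

/-- The case `n = 2`, `m` even, with the contribution of `c 1 ^ 2` split off. -/
theorem abs_two_even_sub_le (hc : IsCosMoment c) (hlam : 1 ≤ lam) : ∀ l : ℕ,
    |(lam * A 2 * A (2 * l + 2) - A (2 * l + 3)) - (4 * lam * (c 1 * c 1) - 2 * c 2 - 1)|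
      ≤ (4 * lam - 2) * l
  | 0 => by
    have h : (lam * A 2 * A (2 * 0 + 2) - A (2 * 0 + 3))
        - (4 * lam * (c 1 * c 1) - 2 * c 2 - 1) = 0 := by
      simp [sinRatioMoment]; ring
    rw [h]; simp
  | l + 1 => by
    have h1 := abs_two_even_sub_le hc hlam l
    have h2 := hc.abs_four_mul_sub_le hlam 1 (2 * l + 3)
    have e1 : A (2 * (l + 1) + 2) = A (2 * l + 2) + 2 * c (2 * l + 3) := rfl
    have e2 : A (2 * (l + 1) + 3) = A (2 * l + 3) + 2 * c (1 + (2 * l + 3)) := by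
      rw [show 2 * (l + 1) + 3 = 2 * l + 3 + 2 by ring, sinRatioMoment]
      congr 3; ring
    have h3 := abs_add_le
      ((lam * A 2 * A (2 * l + 2) - A (2 * l + 3)) - (4 * lam * (c 1 * c 1) - 2 * c 2 - 1))
      (4 * lam * (c 1 * c (2 * l + 3)) - 2 * c (1 + (2 * l + 3)))
    rw [e1, e2]
    push_cast
    calc _ = |(lam * A 2 * A (2 * l + 2) - A (2 * l + 3)) - (4 * lam * (c 1 * c 1) - 2 * c 2 - 1)
        + (4 * lam * (c 1 * c (2 * l + 3)) - 2 * c (1 + (2 * l + 3)))| := by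
          rw [sinRatioMoment_two]; ring_nf
      _ ≤ _ := by linarith

/-- Above, write it as `2 (2 (c 1)² - c 2) + 4 (λ - 1) (c 1)² - 1`; below, drop the square and use
`c 2 ≤ 1`. -/
theorem abs_core_le (hc : IsCosMoment c) (hlam : 1 ≤ lam) :
    4 * lam * (c 1 * c 1) - 2 * c 2 - 1 ≤ 4 * lam - 3 ∧
      -3 ≤ 4 * lam * (c 1 * c 1) - 2 * c 2 - 1 := by
  have h1 := abs_le.1 (hc.abs_two_mul_sub_le 1 1)
  have h2 := abs_le.1 (hc.abs_mul_le_one 1 1)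
  have h3 := abs_le.1 (hc.abs_le_one 2)
  have h4 := mul_self_nonneg (c 1)
  norm_num at h1
  constructor <;> nlinarith [h1.1, h1.2, h2.1, h2.2, h3.1, h3.2]

theorem abs_le_of_two_even_of_le (hc : IsCosMoment c) (hlam : 1 ≤ lam) (hlam' : lam ≤ 3 / 2)
    (l : ℕ) : |lam * A 2 * A (2 * l + 2) - A (2 * l + 3)| ≤ 3 + (2 * lam - 1) * (2 * l) := by
  have h1 := abs_le.1 (hc.abs_two_even_sub_le hlam l)
  have h2 := hc.abs_core_le hlam
  rw [abs_le]
  constructor <;> linarith [h1.1, h1.2, h2.1, h2.2]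

theorem abs_le_of_two_even_of_ge (hc : IsCosMoment c) (hlam : 3 / 2 ≤ lam) (l : ℕ) :
    |lam * A 2 * A (2 * l + 2) - A (2 * l + 3)| ≤ 2 * lam * (2 * l + 2) - (2 * l + 2) - 1 := by
  have h1 := abs_le.1 (hc.abs_two_even_sub_le (by linarith) l)
  have h2 := hc.abs_core_le (by linarith : 1 ≤ lam)
  rw [abs_le]
  constructor <;> linarith [h1.1, h1.2, h2.1, h2.2]

/-- The contribution of `c 3` to the functional, with the terms involving `c 1` and
`c (m + 3)` split off. -/
theorem abs_block_three_le (hc : IsCosMoment c) (hlam : 1 ≤ lam) : ∀ l : ℕ,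
    |2 * lam * (c 3 * A (2 * l + 2)) - 4 * lam * (c 3 * c 1)| ≤ 4 * lam * l
  | 0 => by
    have h : 2 * lam * (c 3 * A (2 * 0 + 2)) - 4 * lam * (c 3 * c 1) = 0 := by
      simp [sinRatioMoment]; ring
    rw [h]; simp
  | l + 1 => by
    have h1 := abs_le.1 (abs_block_three_le hc hlam l)
    have h2 := abs_le.1 (hc.abs_mul_le_one 3 (2 * l + 3))
    have e1 : A (2 * (l + 1) + 2) = A (2 * l + 2) + 2 * c (2 * l + 3) := rfl
    rw [e1, abs_le]
    push_cast
    constructor <;> nlinarith [h1.1, h1.2, h2.1, h2.2]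

/-- Adding the separate bounds suffices above, but below only for `λ ≥ 3/2`. The lower bound
therefore couples `c 3`, `c 1` and `c 2` through `|2 c 3 c 1 - c 2| ≤ 1`. -/
theorem abs_le_of_four_even (hc : IsCosMoment c) (hlam : 1 ≤ lam) (l : ℕ) :
    |lam * A 4 * A (2 * l + 4) - A (2 * l + 7)|
      ≤ lam * 4 * (2 * l + 4) - 4 - (2 * l + 4) + 1 := by
  have h1 := abs_le.1 (hc.abs_two_even_sub_le hlam (l + 1))
  have h2 := abs_le.1 (hc.abs_block_three_le hlam l)
  have h3 := abs_le.1 (hc.abs_four_mul_sub_le hlam 3 (2 * l + 3))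
  have h4 := abs_le.1 (hc.abs_block_le hlam 3 (2 * l + 2))
  have h5 := hc.abs_core_le hlam
  have h6 := abs_le.1 (hc.abs_two_mul_sub_le' 2 1)
  have h7 := abs_le.1 (hc.abs_mul_le_one 3 1)
  have h8 := abs_le.1 (hc.abs_le_one 2)
  have h9 := mul_self_nonneg (c 1)
  have e1 : A (2 * l + 4) = A (2 * l + 2) + 2 * c (2 * l + 3) := rfl
  have e2 : A (2 * l + 7) = A (2 * (l + 1) + 3) + 2 * c (2 * l + 6) := rfl
  have e3 : A 4 = A 2 + 2 * c 3 := rfl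
  have e4 : A (2 * (l + 1) + 2) = A (2 * l + 4) := rfl
  have e5 : A (2 * l + 2 + 2) = A (2 * l + 4) := rfl
  have i1 : 3 + (2 * l + 3) = 2 * l + 6 := by ring
  have i2 : 3 + (2 * l + 2 + 1) = 2 * l + 6 := by ring
  rw [i1] at h3
  rw [i2, e5] at h4
  rw [e4] at h1
  push_cast at h1 h4
  norm_num at h6
  rw [e2, e3, abs_le]
  have split : lam * (A 2 + 2 * c 3) * A (2 * l + 4) - (A (2 * (l + 1) + 3) + 2 * c (2 * l + 6))
      = (lam * A 2 * A (2 * l + 4) - A (2 * (l + 1) + 3))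
        + (2 * lam * (c 3 * A (2 * l + 4)) - 2 * c (2 * l + 6)) := by ring
  have k1 : 2 * lam * (c 3 * A (2 * l + 4)) = 2 * lam * (c 3 * A (2 * l + 2))
      + 4 * lam * (c 3 * c (2 * l + 3)) := by rw [e1]; ring
  rw [split]
  constructor
  -- Here `4λ c 3 c 1 = 4 (λ - 1) c 3 c 1 + 4 c 3 c 1`, and `4 c 3 c 1 ≥ 2 c 2 - 2` cancels the `-2
  -- c 2` of the core.
  · have k2 : 0 ≤ lam * (c 1 * c 1) := mul_nonneg (by linarith) h9
    have k3 : -(lam - 1) ≤ (lam - 1) * (c 3 * c 1) := by nlinarith [h7.1]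
    linarith [h1.1, h2.1, h3.1, h5.2, h6.1, h8.1, h8.2]
  · linarith [h1.2, h4.2, h5.1]

theorem abs_le_of_even (hc : IsCosMoment c) (hlam : 1 ≤ lam) (l : ℕ) : ∀ h : ℕ,
    |lam * A (2 * h + 4) * A (2 * l + 4) - A (2 * h + 2 * l + 7)|
      ≤ lam * (2 * h + 4) * (2 * l + 4) - (2 * h + 4) - (2 * l + 4) + 1
  | 0 => by simpa using hc.abs_le_of_four_even hlam l
  | h + 1 => by
    have h1 := abs_le_of_even hc hlam l h
    have h2 := hc.abs_block_le hlam (2 * h + 5) (2 * l + 2)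
    have e1 : A (2 * (h + 1) + 4) = A (2 * h + 4) + 2 * c (2 * h + 5) := rfl
    have e2 : A (2 * (h + 1) + 2 * l + 7)
        = A (2 * h + 2 * l + 7) + 2 * c (2 * h + 5 + (2 * l + 2 + 1)) := by
      rw [show 2 * (h + 1) + 2 * l + 7 = 2 * h + 2 * l + 7 + 2 by ring, sinRatioMoment]
      congr 3; ring
    have e3 : A (2 * l + 2 + 2) = A (2 * l + 4) := rfl
    rw [e3] at h2
    have h3 := abs_add_le (lam * A (2 * h + 4) * A (2 * l + 4) - A (2 * h + 2 * l + 7))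
      (2 * lam * (c (2 * h + 5) * A (2 * l + 4)) - 2 * c (2 * h + 5 + (2 * l + 2 + 1)))
    rw [e1, e2]
    push_cast at h2 ⊢
    calc _ = |lam * A (2 * h + 4) * A (2 * l + 4) - A (2 * h + 2 * l + 7)
        + (2 * lam * (c (2 * h + 5) * A (2 * l + 4))
          - 2 * c (2 * h + 5 + (2 * l + 2 + 1)))| := by ring_nf
      _ ≤ _ := by linarith

end IsCosMoment

/-! ### Moment inequalities for a probability density. -/

section Moments

variable {W : ℝ → ℝ}

theorem sq_integral_mul_le (hW : Continuous W) (h0 : ∀ θ, 0 ≤ W θ)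
    (h1 : ∫ θ in (0 : ℝ)..2 * Real.pi, W θ = 1) {X : ℝ → ℝ} (hX : Continuous X) :
    (∫ θ in (0 : ℝ)..2 * Real.pi, X θ * W θ) ^ 2 ≤
      ∫ θ in (0 : ℝ)..2 * Real.pi, X θ ^ 2 * W θ := by
  set e := ∫ θ in (0 : ℝ)..2 * Real.pi, X θ * W θ with he
  have h : 0 ≤ ∫ θ in (0 : ℝ)..2 * Real.pi, (X θ - e) ^ 2 * W θ :=
    intervalIntegral.integral_nonneg (by positivity) fun θ _ => mul_nonneg (sq_nonneg _) (h0 θ)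
  have h2 : ∀ θ, (X θ - e) ^ 2 * W θ = X θ ^ 2 * W θ - 2 * e * (X θ * W θ) + e ^ 2 * W θ :=
    fun θ => by ring
  simp_rw [h2] at h
  rw [intervalIntegral.integral_add, intervalIntegral.integral_sub,
    intervalIntegral.integral_const_mul, intervalIntegral.integral_const_mul, h1, ← he] at h
  · linarith
  all_goals exact Continuous.intervalIntegrable (by fun_prop) _ _

theorem integral_mul_le_one (hW : Continuous W) (h0 : ∀ θ, 0 ≤ W θ)
    (h1 : ∫ θ in (0 : ℝ)..2 * Real.pi, W θ = 1) {X : ℝ → ℝ} (hX : Continuous X)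
    (hX1 : ∀ θ, X θ ≤ 1) : ∫ θ in (0 : ℝ)..2 * Real.pi, X θ * W θ ≤ 1 := by
  rw [← h1]
  exact intervalIntegral.integral_mono_on (by positivity)
    (Continuous.intervalIntegrable (by fun_prop) _ _) (hW.intervalIntegrable _ _)
    fun θ _ => mul_le_of_le_one_left (h0 θ) (hX1 θ)

/-- For `σ = ±1`, `((cos x + σ cos y)/2)² ≤ (1 + σ cos(x+y))/2` pointwise, the gap being `(sin x - σ
sin y)²/4`. The variance inequality carries this over to the moments. -/
theorem abs_two_mul_integral_cos_sub_le (hW : Continuous W) (h0 : ∀ θ, 0 ≤ W θ)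
    (h1 : ∫ θ in (0 : ℝ)..2 * Real.pi, W θ = 1) (a b : ℝ) :
    |2 * ((∫ θ in (0 : ℝ)..2 * Real.pi, Real.cos (a * θ) * W θ) *
        ∫ θ in (0 : ℝ)..2 * Real.pi, Real.cos (b * θ) * W θ) -
      ∫ θ in (0 : ℝ)..2 * Real.pi, Real.cos ((a + b) * θ) * W θ| ≤ 1 := by
  set p := ∫ θ in (0 : ℝ)..2 * Real.pi, Real.cos (a * θ) * W θ with hp
  set q := ∫ θ in (0 : ℝ)..2 * Real.pi, Real.cos (b * θ) * W θ with hq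
  set s := ∫ θ in (0 : ℝ)..2 * Real.pi, Real.cos ((a + b) * θ) * W θ with hs
  have key : ∀ σ : ℝ, σ ^ 2 = 1 → ((p + σ * q) / 2) ^ 2 ≤ (1 + σ * s) / 2 := by
    intro σ hσ
    have e1 : (p + σ * q) / 2 = ∫ θ in (0 : ℝ)..2 * Real.pi,
        ((Real.cos (a * θ) + σ * Real.cos (b * θ)) / 2) * W θ := by
      have : ∀ θ, ((Real.cos (a * θ) + σ * Real.cos (b * θ)) / 2) * W θ
          = 1 / 2 * (Real.cos (a * θ) * W θ) + σ / 2 * (Real.cos (b * θ) * W θ) :=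
        fun θ => by ring
      simp_rw [this]
      rw [intervalIntegral.integral_add, intervalIntegral.integral_const_mul,
        intervalIntegral.integral_const_mul]
      · rw [hp, hq]; ring
      all_goals exact Continuous.intervalIntegrable (by fun_prop) _ _
    have e2 : (1 + σ * s) / 2 = ∫ θ in (0 : ℝ)..2 * Real.pi,
        ((1 + σ * Real.cos ((a + b) * θ)) / 2) * W θ := by
      have : ∀ θ, ((1 + σ * Real.cos ((a + b) * θ)) / 2) * W θ
          = 1 / 2 * W θ + σ / 2 * (Real.cos ((a + b) * θ) * W θ) := fun θ => by ring
      simp_rw [this]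
      rw [intervalIntegral.integral_add, intervalIntegral.integral_const_mul,
        intervalIntegral.integral_const_mul, h1]
      · rw [hs]; ring
      all_goals exact Continuous.intervalIntegrable (by fun_prop) _ _
    rw [e1, e2]
    refine (sq_integral_mul_le hW h0 h1 (by fun_prop)).trans
      (intervalIntegral.integral_mono_on (by positivity)
        (Continuous.intervalIntegrable (by fun_prop) _ _)
        (Continuous.intervalIntegrable (by fun_prop) _ _) fun θ _ => ?_)
    refine mul_le_mul_of_nonneg_right ?_ (h0 θ)
    have hab : Real.cos ((a + b) * θ)
        = Real.cos (a * θ) * Real.cos (b * θ) - Real.sin (a * θ) * Real.sin (b * θ) := by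
      rw [add_mul, Real.cos_add]
    have ha := Real.sin_sq_add_cos_sq (a * θ)
    have hb := Real.sin_sq_add_cos_sq (b * θ)
    have hsq := sq_nonneg (Real.sin (a * θ) - σ * Real.sin (b * θ))
    rw [hab]
    have hb' := congrArg (σ ^ 2 * ·) hb
    simp only [mul_one] at hb'
    nlinarith
  have k1 := key 1 (by norm_num)
  have k2 := key (-1) (by norm_num)
  rw [abs_le]
  -- Uses `4pq ≤ (p+q)²` and `-4pq ≤ (p-q)²`.
  constructor <;> nlinarith [sq_nonneg (p - q), sq_nonneg (p + q)]

theorem isCosMoment_integral (hW : Continuous W) (h0 : ∀ θ, 0 ≤ W θ)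
    (h1 : ∫ θ in (0 : ℝ)..2 * Real.pi, W θ = 1) :
    IsCosMoment fun j => ∫ θ in (0 : ℝ)..2 * Real.pi, Real.cos (j * θ) * W θ where
  abs_le_one j := by
    rw [abs_le]
    constructor
    · have h := integral_mul_le_one hW h0 h1 (X := fun θ => -Real.cos (j * θ)) (by fun_prop)
        fun θ => by linarith [Real.neg_one_le_cos (j * θ)]
      simp only [neg_mul, intervalIntegral.integral_neg] at h
      linarith
    · exact integral_mul_le_one hW h0 h1 (by fun_prop) fun θ => Real.cos_le_one _
  abs_two_mul_sub_le j k := by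
    simpa using abs_two_mul_integral_cos_sub_le hW h0 h1 j k
  abs_two_mul_sub_le' j k := by
    -- Frequency `-k` has the same moment as `k`, since cosine is even.
    simpa using abs_two_mul_integral_cos_sub_le hW h0 h1 (j + k) (-k)

end Moments

/-! ### From coefficients to moments, and the limit `r → 1`. -/

namespace TypicallyReal

variable {f : ℂ → ℂ}

/-- The coefficients of `z ↦ f (r z) / r` are moments of a probability measure. -/
theorem exists_isCosMoment (hf : f ∈ TypicallyReal) {r : ℝ} (hr : 0 < r) (hr1 : r < 1) :
    ∃ c, IsCosMoment c ∧ ∀ n, (taylorCoeff f n).re * r ^ n = r * sinRatioMoment c n := by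
  have hc := continuous_comp_circleMap hf.1.1 hr hr1
  let F : ℝ → ℝ := fun θ => (f (circleMap 0 r θ)).im
  have hF : Continuous F := Complex.continuous_im.comp hc
  have hpr : 0 < Real.pi * r := by positivity
  have hint : ∀ n : ℕ, ∫ θ in (0 : ℝ)..2 * Real.pi, F θ * Real.sin (n * θ)
      = Real.pi * ((taylorCoeff f n).re * r ^ n) := by
    intro n
    rcases n with _ | n
    · simp [taylorCoeff_zero hf]
    · rw [integral_im_mul_sin hf.1.1 hr hr1]; ring
  let W : ℝ → ℝ := fun θ => F θ * Real.sin θ / (Real.pi * r)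
  have hW : Continuous W := by fun_prop
  have hW0 : ∀ θ, 0 ≤ W θ := by
    intro θ
    have hz : circleMap 0 r θ ∈ Metric.ball (0 : ℂ) 1 := by
      simpa [circleMap, abs_of_pos hr] using hr1
    have h := im_mul_im_nonneg hf hz
    have him : (circleMap 0 r θ).im = r * Real.sin θ := by
      simp [circleMap, Complex.exp_ofReal_mul_I_im]
    rw [him] at h
    refine div_nonneg ?_ hpr.le
    exact nonneg_of_mul_nonneg_right (by linarith [show r * (F θ * Real.sin θ)
      = (f (circleMap 0 r θ)).im * (r * Real.sin θ) by simp only [F]; ring]) hr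
  have hW1 : ∫ θ in (0 : ℝ)..2 * Real.pi, W θ = 1 := by
    have h := hint 1
    simp only [Nat.cast_one, one_mul, taylorCoeff_one hf, Complex.one_re, pow_one] at h
    simp only [W]
    rw [intervalIntegral.integral_div, h, div_self hpr.ne']
  refine ⟨_, isCosMoment_integral hW hW0 hW1, fun n => ?_⟩
  induction n using Nat.twoStepInduction with
  | zero => simp [taylorCoeff_zero hf, sinRatioMoment]
  | one => simp [taylorCoeff_one hf, sinRatioMoment]
  | more n ih _ =>
    rw [sinRatioMoment, mul_add, ← ih]
    have h2 := hint (n + 2)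
    have hrec : ∀ θ, F θ * Real.sin ((n + 2 : ℕ) * θ) = F θ * Real.sin (n * θ)
        + 2 * (Real.pi * r) * (Real.cos ((n + 1 : ℕ) * θ) * W θ) := by
      intro θ
      have e1 : ((n + 2 : ℕ) : ℝ) * θ = (n + 1 : ℕ) * θ + θ := by push_cast; ring
      have e2 : (n : ℝ) * θ = (n + 1 : ℕ) * θ - θ := by push_cast; ring
      rw [e1, e2, Real.sin_add, Real.sin_sub]
      simp only [W]
      field_simp
      ring
    simp_rw [hrec] at h2
    rw [intervalIntegral.integral_add, intervalIntegral.integral_const_mul, hint] at h2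
    · refine mul_left_cancel₀ Real.pi_ne_zero ?_
      rw [← h2]; ring
    all_goals exact Continuous.intervalIntegrable (by fun_prop) _ _

theorem zalcman_eq (hf : f ∈ TypicallyReal) (n m : ℕ) (lam : ℝ) :
    zalcman f n m lam = |lam * (taylorCoeff f n).re * (taylorCoeff f m).re
      - (taylorCoeff f (n + m - 1)).re| := by
  rw [zalcman, taylorCoeff_eq_re hf n, taylorCoeff_eq_re hf m, taylorCoeff_eq_re hf (n + m - 1),
    ← Real.norm_eq_abs, ← Complex.norm_real]
  push_cast
  rfl

theorem zalcman_le (hf : f ∈ TypicallyReal) {n m N : ℕ} (hN : n + m = N + 1) {lam B : ℝ}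
    (hB : ∀ c, IsCosMoment c →
      |lam * sinRatioMoment c n * sinRatioMoment c m - sinRatioMoment c N| ≤ B) :
    zalcman f n m lam ≤ B := by
  rw [zalcman_eq hf, show n + m - 1 = N by omega]
  set Z := |lam * (taylorCoeff f n).re * (taylorCoeff f m).re - (taylorCoeff f N).re|
  have hlim : Filter.Tendsto (fun r : ℝ => Z * r ^ (n + m)) (nhdsWithin 1 (Set.Iio 1))
      (nhds Z) := by
    have h : Continuous fun r : ℝ => Z * r ^ (n + m) := by fun_prop
    simpa using (h.tendsto 1).mono_left nhdsWithin_le_nhds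
  refine le_of_tendsto hlim ?_
  filter_upwards [Ioo_mem_nhdsLT (zero_lt_one (α := ℝ))] with r hr
  obtain ⟨c, hc, hcoef⟩ := exists_isCosMoment hf hr.1 hr.2
  have hb := hB c hc
  -- Both terms scale alike because `n + m = N + 1`: each yields a factor `r²`.
  have h : Z * r ^ (n + m) = r ^ 2 *
      |lam * sinRatioMoment c n * sinRatioMoment c m - sinRatioMoment c N| := by
    rw [← abs_of_pos (pow_pos hr.1 (n + m)), ← abs_of_pos (pow_pos hr.1 2), ← abs_mul, ← abs_mul]
    congr 1
    have h1 := hcoef n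
    have h2 := hcoef m
    have h3 := hcoef N
    have h4 : r ^ (n + m) = r ^ N * r := by rw [hN, pow_succ]
    calc _ = lam * ((taylorCoeff f n).re * r ^ n) * ((taylorCoeff f m).re * r ^ m)
          - (taylorCoeff f N).re * r ^ N * r := by
            rw [sub_mul, h4, mul_assoc _ (r ^ N) r, ← h4, pow_add]; ring
      _ = _ := by rw [h1, h2, h3]; ring
  rw [h]
  exact (mul_le_of_le_one_left (abs_nonneg _) (pow_le_one₀ hr.1.le hr.2.le)).trans hb

end TypicallyReal

theorem zalcman_comm (f : ℂ → ℂ) (n m : ℕ) (lam : ℝ) : zalcman f n m lam = zalcman f m n lam := by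
  rw [zalcman, zalcman, add_comm n m, mul_right_comm]

/-! ### Extremal functions. -/

/-- The Koebe function. -/
noncomputable def koebe (z : ℂ) : ℂ := z / (1 - z) ^ 2

/-- The odd part of the Koebe function. -/
noncomputable def oddKoebe (z : ℂ) : ℂ := (koebe z - koebe (-z)) / 2

theorem one_sub_ne_zero_of_norm_lt {z : ℂ} (hz : ‖z‖ < 1) : 1 - z ≠ 0 := by
  intro h
  rw [← sub_eq_zero.1 h] at hz
  simp at hz

theorem koebe_im {z : ℂ} (hz : ‖z‖ < 1) :
    (koebe z).im = z.im * ((1 - ‖z‖ ^ 2) / Complex.normSq (1 - z) ^ 2) := by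
  have h : Complex.normSq (1 - z) ≠ 0 := by
    simpa [Complex.normSq_eq_zero] using one_sub_ne_zero_of_norm_lt hz
  rw [koebe, Complex.div_im, map_pow, ← Complex.normSq_eq_norm_sq]
  field_simp
  simp [Complex.normSq_apply, sq]
  ring

theorem koebe_factor_pos {z : ℂ} (hz : ‖z‖ < 1) :
    0 < (1 - ‖z‖ ^ 2) / Complex.normSq (1 - z) ^ 2 := by
  have h := Complex.normSq_pos.2 (one_sub_ne_zero_of_norm_lt hz)
  have h2 : ‖z‖ ^ 2 < 1 := by nlinarith [norm_nonneg z]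
  have h3 : 0 < 1 - ‖z‖ ^ 2 := by linarith
  positivity

theorem taylorCoeff_koebe (n : ℕ) : taylorCoeff koebe n = n :=
  taylorCoeff_eq_of_hasSum (a := fun n => (n : ℂ))
    (fun _ hz => hasSum_coe_mul_geometric_of_norm_lt_one hz) n

theorem taylorCoeff_oddKoebe (n : ℕ) : taylorCoeff oddKoebe n = n * (1 - (-1) ^ n) / 2 := by
  refine taylorCoeff_eq_of_hasSum (a := fun n => (n : ℂ) * (1 - (-1) ^ n) / 2) (fun z hz => ?_) n
  have h1 := hasSum_coe_mul_geometric_of_norm_lt_one hz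
  have h2 := hasSum_coe_mul_geometric_of_norm_lt_one (show ‖-z‖ < 1 by simpa using hz)
  refine ((h1.sub h2).div_const 2).congr_fun fun k => ?_
  rw [neg_pow]
  ring

theorem differentiableOn_koebe : DifferentiableOn ℂ koebe (Metric.ball 0 1) := by
  intro z hz
  have := one_sub_ne_zero_of_norm_lt (by simpa using hz)
  unfold koebe
  exact (DifferentiableAt.div (by fun_prop) (by fun_prop)
    (by simpa using this)).differentiableWithinAt

theorem differentiableOn_oddKoebe : DifferentiableOn ℂ oddKoebe (Metric.ball 0 1) := by
  unfold oddKoebe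
  refine (differentiableOn_koebe.sub
    (differentiableOn_koebe.comp (differentiableOn_neg _) ?_)).div_const 2
  intro z hz
  simpa using hz

theorem koebe_mem_typicallyReal : koebe ∈ TypicallyReal := by
  refine ⟨⟨differentiableOn_koebe, by simp [koebe], ?_⟩, fun z hz => ?_⟩
  · simpa [taylorCoeff] using taylorCoeff_koebe 1
  · have hz' : ‖z‖ < 1 := by simpa using hz
    rw [koebe_im hz', mul_eq_zero, or_iff_left (koebe_factor_pos hz').ne']

theorem oddKoebe_mem_typicallyReal : oddKoebe ∈ TypicallyReal := by
  refine ⟨⟨differentiableOn_oddKoebe, by simp [oddKoebe, koebe], ?_⟩, fun z hz => ?_⟩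
  · have h := taylorCoeff_oddKoebe 1
    norm_num [taylorCoeff] at h
    exact h
  · have hz' : ‖z‖ < 1 := by simpa using hz
    have hz'' : ‖-z‖ < 1 := by simpa using hz
    have h := add_pos (koebe_factor_pos hz') (koebe_factor_pos hz'')
    have him : (oddKoebe z).im = z.im * (((1 - ‖z‖ ^ 2) / Complex.normSq (1 - z) ^ 2
        + (1 - ‖-z‖ ^ 2) / Complex.normSq (1 - -z) ^ 2) / 2) := by
      rw [oddKoebe, Complex.div_ofNat_im, Complex.sub_im, koebe_im hz', koebe_im hz'',
        Complex.neg_im]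
      ring
    rw [him, mul_eq_zero, or_iff_left (by positivity)]

theorem zalcman_koebe {n m : ℕ} (hn : 2 ≤ n) (hm : 2 ≤ m) {lam : ℝ} (hlam : 1 ≤ lam) :
    zalcman koebe n m lam = lam * m * n - n - m + 1 := by
  rw [TypicallyReal.zalcman_eq koebe_mem_typicallyReal]
  simp only [taylorCoeff_koebe, Complex.natCast_re]
  have hn' : (2 : ℝ) ≤ n := by exact_mod_cast hn
  have hm' : (2 : ℝ) ≤ m := by exact_mod_cast hm
  rw [Nat.cast_sub (by omega), abs_of_nonneg] <;> push_cast
  · ring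
  · nlinarith [mul_nonneg (sub_nonneg.2 hn') (sub_nonneg.2 hm'),
      mul_le_mul_of_nonneg_right hlam (by positivity : (0 : ℝ) ≤ n * m)]

theorem zalcman_oddKoebe {n m : ℕ} (hn : Even n) (hm : Even m) (hm2 : 2 ≤ m) (lam : ℝ) :
    zalcman oddKoebe n m lam = n + m - 1 := by
  have hodd : Odd (n + m - 1) := Nat.Even.sub_odd (by omega) (hn.add hm) odd_one
  rw [zalcman, taylorCoeff_oddKoebe, taylorCoeff_oddKoebe, taylorCoeff_oddKoebe, hn.neg_one_pow,
    hm.neg_one_pow, hodd.neg_one_pow]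
  norm_num
  rw [Nat.cast_sub (by omega)]
  push_cast
  ring

/-! ### Bounds by parity and sharpness. -/

theorem zalcman_le_of_odd {f : ℂ → ℂ} (hf : f ∈ TypicallyReal) {n m : ℕ} (hn : Odd n)
    (hm : 2 ≤ m) {lam : ℝ} (hlam : 1 ≤ lam) :
    zalcman f n m lam ≤ lam * m * n - n - m + 1 := by
  obtain ⟨h, rfl⟩ := hn
  obtain ⟨k, rfl⟩ := Nat.exists_eq_add_of_le' hm
  refine TypicallyReal.zalcman_le hf (N := 2 * h + (k + 2)) (by ring) fun c hc => ?_
  have := hc.abs_le_of_odd hlam k h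
  push_cast
  linarith

theorem zalcman_le_of_even {f : ℂ → ℂ} (hf : f ∈ TypicallyReal) {n m : ℕ} (hn : Even n)
    (hm : Even m) (hn4 : 4 ≤ n) (hm4 : 4 ≤ m) {lam : ℝ} (hlam : 1 ≤ lam) :
    zalcman f n m lam ≤ lam * m * n - n - m + 1 := by
  obtain ⟨h, rfl⟩ : ∃ h, n = 2 * h + 4 := by
    obtain ⟨h, rfl⟩ := hn; exact ⟨h - 2, by omega⟩
  obtain ⟨l, rfl⟩ : ∃ l, m = 2 * l + 4 := by
    obtain ⟨l, rfl⟩ := hm; exact ⟨l - 2, by omega⟩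
  refine TypicallyReal.zalcman_le hf (N := 2 * h + 2 * l + 7) (by ring) fun c hc => ?_
  have := hc.abs_le_of_even hlam l h
  push_cast
  linarith

theorem zalcman_two_even {m : ℕ} (hm : 2 ≤ m) (hme : Even m) {lam : ℝ} (hlam : 1 ≤ lam) :
    (lam ≤ 3 / 2 →
      (∀ f ∈ TypicallyReal, zalcman f 2 m lam ≤ 3 + (2 * lam - 1) * ((m : ℝ) - 2)) ∧
      ((lam = 1 ∨ m = 2) →
        ∃ f ∈ TypicallyReal, zalcman f 2 m lam = 3 + (2 * lam - 1) * ((m : ℝ) - 2))) ∧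
    (3 / 2 ≤ lam →
      (∀ f ∈ TypicallyReal, zalcman f 2 m lam ≤ 2 * lam * m - m - 1) ∧
      (∃ f ∈ TypicallyReal, zalcman f 2 m lam = 2 * lam * m - m - 1)) := by
  refine ⟨fun hlam' => ⟨fun f hf => ?_, fun h => ⟨oddKoebe, oddKoebe_mem_typicallyReal, ?_⟩⟩,
    fun hlam' => ⟨fun f hf => ?_, koebe, koebe_mem_typicallyReal, ?_⟩⟩
  · obtain ⟨l, rfl⟩ : ∃ l, m = 2 * l + 2 := by
      obtain ⟨l, rfl⟩ := hme; exact ⟨l - 1, by omega⟩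
    refine TypicallyReal.zalcman_le hf (N := 2 * l + 3) (by ring) fun c hc => ?_
    have := hc.abs_le_of_two_even_of_le hlam hlam' l
    push_cast
    linarith
  -- The value `m + 1` meets the bound exactly when `λ = 1` or `m = 2`.
  · rw [zalcman_oddKoebe even_two hme hm]
    rcases h with rfl | rfl <;> push_cast <;> ring
  · obtain ⟨l, rfl⟩ : ∃ l, m = 2 * l + 2 := by
      obtain ⟨l, rfl⟩ := hme; exact ⟨l - 1, by omega⟩
    refine TypicallyReal.zalcman_le hf (N := 2 * l + 3) (by ring) fun c hc => ?_
    have := hc.abs_le_of_two_even_of_ge hlam' l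
    push_cast
    linarith
  · rw [zalcman_koebe le_rfl hm hlam]
    push_cast
    ring

theorem mainTheorem4 (n m : ℕ) (hn : 2 ≤ n) (hm : 2 ≤ m) (lam : ℝ) (hlam : 1 ≤ lam) :
    -- (i) `n = 2` and `m` even
    (n = 2 → Even m →
      (lam ≤ 3 / 2 →
        (∀ f ∈ TypicallyReal, zalcman f n m lam ≤ 3 + (2 * lam - 1) * ((m : ℝ) - 2)) ∧
        ((lam = 1 ∨ (n = 2 ∧ m = 2)) →
          ∃ f ∈ TypicallyReal, zalcman f n m lam = 3 + (2 * lam - 1) * ((m : ℝ) - 2))) ∧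
      (3 / 2 ≤ lam →
        (∀ f ∈ TypicallyReal, zalcman f n m lam ≤ 2 * lam * m - m - 1) ∧
        (∃ f ∈ TypicallyReal, zalcman f n m lam = 2 * lam * m - m - 1))) ∧
    -- (ii) `m = 2` and `n` even
    (m = 2 → Even n →
      (lam ≤ 3 / 2 →
        (∀ f ∈ TypicallyReal, zalcman f n m lam ≤ 3 + (2 * lam - 1) * ((n : ℝ) - 2)) ∧
        ((lam = 1 ∨ (n = 2 ∧ m = 2)) →
          ∃ f ∈ TypicallyReal, zalcman f n m lam = 3 + (2 * lam - 1) * ((n : ℝ) - 2))) ∧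
      (3 / 2 ≤ lam →
        (∀ f ∈ TypicallyReal, zalcman f n m lam ≤ 2 * lam * n - n - 1) ∧
        (∃ f ∈ TypicallyReal, zalcman f n m lam = 2 * lam * n - n - 1))) ∧
    -- (iii) all other cases
    (¬ (n = 2 ∧ Even m) → ¬ (m = 2 ∧ Even n) →
      (∀ f ∈ TypicallyReal, zalcman f n m lam ≤ lam * m * n - n - m + 1) ∧
      (∃ f ∈ TypicallyReal, zalcman f n m lam = lam * m * n - n - m + 1)) := by
  refine ⟨?_, ?_, ?_⟩
  · rintro rfl hme
    simpa using zalcman_two_even hm hme hlam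
  · rintro rfl hne
    simp_rw [fun f => zalcman_comm f n 2 lam]
    simpa using zalcman_two_even hn hne hlam
  · intro h1 h2
    refine ⟨fun f hf => ?_, koebe, koebe_mem_typicallyReal, zalcman_koebe hn hm hlam⟩
    rcases Nat.even_or_odd n with hne | hno
    · rcases Nat.even_or_odd m with hme | hmo
      · have hn2 : n ≠ 2 := fun h => h1 ⟨h, hme⟩
        have hm2 : m ≠ 2 := fun h => h2 ⟨h, hne⟩
        have hn3 : n ≠ 3 := by rintro rfl; exact absurd hne (by decide)
        have hm3 : m ≠ 3 := by rintro rfl; exact absurd hme (by decide)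
        exact zalcman_le_of_even hf hne hme (by omega) (by omega) hlam
      · rw [zalcman_comm]
        linarith [zalcman_le_of_odd hf hmo hn hlam]
    · exact zalcman_le_of_odd hf hno hm hlam
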